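/- Let $\mathcal G$ be the group of finite sets of nonnegative integers under symmetric difference (neutral element $\emptyset$), let $\mathbf C[\mathcal G]$ be its (commutative) complex group algebra, and let $\psi:\mathbf C[\mathcal G]\to\mathbf C$, $\psi\big(\sum_A x_A A\big)=x_\emptyset$, be its canonical trace. Fix $p\ge 1$, integers $r_1,\dots,r_p\ge 0$ and real numbers $t_0<t_1<\dots<t_p$. For $i=1,\dots,p$ and $n\ge 1$ define $$L_i(n)=n^{-r_i/2}\sum_{(a_1,\dots,a_{r_i})}\{a_1,\dots,a_{r_i}\}\in\mathbf C[\mathcal G],$$ where the sum runs over all $r_i$-tuples of pairwise distinct nonnegative integers of $(nt_{i-1},nt_i]$ (for $r_i=0$, $L_i(n)=\emptyset$ is the unit of the algebra). Then $L_1(n),\dots,L_p(n)$ are asymptotically independent as $n\to\infty$, that is: there exist independent real random variables $X_1,\dots,X_p$ on some probability space, with moments of all orders, such that for every polynomial $P$ in $p$ noncommuting variables with complex coefficients, $$\lim_{n\to\infty}\psi\big(P(L_1(n),\dots,L_p(n))\big)=\mathbf E\big[P(X_1,\dots,X_p)\big].$$ -/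

import Mathlib

open Filter Topology MeasureTheory ProbabilityTheory

/-- The group of finite sets of nonnegative integers under symmetric difference.
The group law is written additively: `A + B` is the symmetric difference of `A` and `B`,
and `0` is the empty set. -/
abbrev FinSetGroup : Type := AsBoolRing (Finset ℕ)

/-- The complex group algebra of the group of finite sets of nonnegative integers. -/
abbrev SetAlgebra : Type := AddMonoidAlgebra ℂ FinSetGroup

/-- The canonical trace: the coefficient of the neutral element (the empty set). -/
noncomputable def canonicalTrace : SetAlgebra →ₗ[ℂ] ℂ where
  toFun x := x.coeff 0
  map_add' _ _ := rfl
  map_smul' _ _ := rfl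

/-- The nonnegative integers of the half-open real interval `(s, t]`. -/
noncomputable def integersIoc (s t : ℝ) : Finset ℕ :=
  (Finset.range (⌊t⌋₊ + 1)).filter (fun a => s < (a : ℝ) ∧ (a : ℝ) ≤ t)

theorem mem_integersIoc (s t : ℝ) (a : ℕ) :
    a ∈ integersIoc s t ↔ s < (a : ℝ) ∧ (a : ℝ) ≤ t := by
  unfold integersIoc
  rw [Finset.mem_filter, Finset.mem_range, and_iff_right_iff_imp]
  intro h
  exact Nat.lt_succ_of_le (Nat.le_floor h.2)

open Classical in
/-- `n ^ (-r/2) ∑ {a₁, …, a_r}`, over all `r`-tuples of pairwise distinct nonnegative integers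
of `(n s, n t]`. -/
noncomputable def normalizedSum (r : ℕ) (s t : ℝ) (n : ℕ) : SetAlgebra :=
  (((n : ℝ) ^ (-(r : ℝ) / 2) : ℝ) : ℂ) •
    ∑ a ∈ (Fintype.piFinset (fun _ : Fin r => integersIoc (n * s) (n * t))).filter
        (fun a => Function.Injective a),
      (AddMonoidAlgebra.single (toBoolRing (Finset.univ.image a)) 1 : SetAlgebra)

/-- The noncommutative distribution of a family `x` of elements of a complex algebra endowed with
a linear form `φ`: it maps a polynomial `P` in noncommuting variables to `φ (P (x))`. -/
noncomputable def ncDistribution {A ι : Type*} [Ring A] [Algebra ℂ A] (φ : A →ₗ[ℂ] ℂ)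
    (x : ι → A) : FreeAlgebra ℂ ι →ₗ[ℂ] ℂ :=
  φ ∘ₗ (FreeAlgebra.lift ℂ x).toLinearMap

/-- Asymptotic independence of the families `x n = (x n i)_i` as `n → ∞`: their distribution
converges, on every polynomial, to the joint distribution of a family of independent real random
variables having moments of all orders. -/
def AsymptoticallyIndependent {A ι : Type*} [Ring A] [Algebra ℂ A] (φ : A →ₗ[ℂ] ℂ)
    (x : ℕ → ι → A) : Prop :=
  ∃ (Ω : Type) (_ : MeasurableSpace Ω) (μ : Measure Ω) (X : ι → Ω → ℝ),
    IsProbabilityMeasure μ ∧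
    (∀ i, Measurable (X i)) ∧
    (∀ i, ∀ q : ℕ, MemLp (X i) q μ) ∧
    iIndepFun X μ ∧
    ∀ P : FreeAlgebra ℂ ι,
      Tendsto (fun n => ncDistribution φ (x n) P) atTop
        (𝓝 (∫ ω, FreeAlgebra.lift ℂ (fun i => ((X i ω : ℝ) : ℂ)) P ∂μ))

/-! The trace is multiplicative on elements supported on disjoint sets of integers, and the algebra
is commutative, so every mixed moment factors exactly into moments of the single `L_i(n)`. Only the
limit of one factor is at stake.

On one interval with `N` integers, the sum over tuples is `r!` times the sum `e_r` of all
`r`-subsets. Since each singleton squares to the unit, `(r+2) e_{r+2} = e_1 e_{r+1} - (N-r) e_r`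
(`elemSum_recursion`). After normalization, the sum of order `r` is a monic polynomial `q_r` in the
sum of order 1, with recursion coefficients `(r+1)(N-r)/n`, which tend to `(r+1)v`: those of the
Hermite polynomials of variance `v`.

The trace kills `q_r` for `r ≥ 1`, just as the Gaussian law kills Hermite polynomials. Solving
triangularly for powers of `X`, the moments of the sum of order 1 become Gaussian
(`tendsto_moments_of_recursivePoly`). The limit variables are thus Hermite polynomials of
independent Gaussians. -/

/-- The basis element of the group algebra attached to a finite set. -/
noncomputable def basisElement (s : Finset ℕ) : SetAlgebra :=
  AddMonoidAlgebra.single (toBoolRing s) 1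

theorem basisElement_empty : basisElement ∅ = 1 := rfl

theorem basisElement_mul (s u : Finset ℕ) :
    basisElement s * basisElement u = basisElement (symmDiff s u) := by
  unfold basisElement
  rw [AddMonoidAlgebra.single_mul_single, one_mul]
  rfl

theorem basisElement_mul_self (s : Finset ℕ) : basisElement s * basisElement s = 1 := by
  rw [basisElement_mul, symmDiff_self]
  rfl

theorem basisElement_insert {a : ℕ} {s : Finset ℕ} (h : a ∉ s) :
    basisElement (insert a s) = basisElement {a} * basisElement s := by
  rw [basisElement_mul]
  congr 1
  ext b
  simp only [Finset.mem_insert, Finset.mem_symmDiff, Finset.mem_singleton]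
  constructor
  · rintro (rfl | hb)
    · exact Or.inl ⟨rfl, h⟩
    · exact Or.inr ⟨hb, fun hba => h (hba ▸ hb)⟩
  · rintro (hb | hb)
    · exact Or.inl hb.1
    · exact Or.inr hb.1

theorem canonicalTrace_basisElement (s : Finset ℕ) :
    canonicalTrace (basisElement s) = if s = ∅ then 1 else 0 := by
  classical
  change (AddMonoidAlgebra.single (toBoolRing s) (1 : ℂ)).coeff (toBoolRing ∅) = _
  rw [AddMonoidAlgebra.coeff_single, Finsupp.single_apply]
  simp only [EmbeddingLike.apply_eq_iff_eq]

theorem canonicalTrace_one : canonicalTrace 1 = 1 := by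
  rw [← basisElement_empty, canonicalTrace_basisElement, if_pos rfl]

/-! ### Multiplicativity of the trace on disjoint supports -/

/-- The subalgebra spanned by the finite subsets of `I`. -/
noncomputable def supportedSubalgebra (I : Set ℕ) : Subalgebra ℂ SetAlgebra :=
  Algebra.adjoin ℂ {x | ∃ s : Finset ℕ, (s : Set ℕ) ⊆ I ∧ x = basisElement s}

theorem basisElement_mem_supportedSubalgebra {I : Set ℕ} {s : Finset ℕ} (h : (s : Set ℕ) ⊆ I) :
    basisElement s ∈ supportedSubalgebra I :=
  Algebra.subset_adjoin ⟨s, h, rfl⟩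

theorem supportedSubalgebra_mono {I J : Set ℕ} (h : I ⊆ J) :
    supportedSubalgebra I ≤ supportedSubalgebra J :=
  Algebra.adjoin_mono fun _ ⟨s, hs, hx⟩ => ⟨s, hs.trans h, hx⟩

/-- The generators are already closed under product, so linear combinations suffice; bilinear
identities need checking only on basis elements. -/
theorem supportedSubalgebra_toSubmodule (I : Set ℕ) :
    Subalgebra.toSubmodule (supportedSubalgebra I) =
      Submodule.span ℂ {x | ∃ s : Finset ℕ, (s : Set ℕ) ⊆ I ∧ x = basisElement s} := by
  let M : Submonoid SetAlgebra :=
    { carrier := {x | ∃ s : Finset ℕ, (s : Set ℕ) ⊆ I ∧ x = basisElement s}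
      one_mem' := ⟨∅, by simp, rfl⟩
      mul_mem' := by
        rintro _ _ ⟨s, hs, rfl⟩ ⟨u, hu, rfl⟩
        refine ⟨symmDiff s u, fun a ha => ?_, basisElement_mul s u⟩
        rcases Finset.mem_symmDiff.1 (Finset.mem_coe.1 ha) with h | h
        · exact hs h.1
        · exact hu h.1 }
  have h := Algebra.adjoin_eq_span ℂ (M : Set SetAlgebra)
  rw [Submonoid.closure_eq] at h
  exact h

/-- By bilinearity it is enough to treat two disjoint finite sets: their symmetric difference is
their union, empty only if both are. -/
theorem canonicalTrace_mul_of_disjoint {I J : Set ℕ} (hIJ : Disjoint I J) {x y : SetAlgebra}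
    (hx : x ∈ supportedSubalgebra I) (hy : y ∈ supportedSubalgebra J) :
    canonicalTrace (x * y) = canonicalTrace x * canonicalTrace y := by
  rw [← Subalgebra.mem_toSubmodule, supportedSubalgebra_toSubmodule] at hx hy
  induction hx, hy using Submodule.span_induction₂ with
  | mem_mem x y hx hy =>
    obtain ⟨s, hs, rfl⟩ := hx
    obtain ⟨u, hu, rfl⟩ := hy
    rw [basisElement_mul]
    simp only [canonicalTrace_basisElement]
    have hsu : Disjoint s u := by
      rw [← Finset.disjoint_coe]
      exact hIJ.mono hs hu
    have : symmDiff s u = ∅ ↔ s = ∅ ∧ u = ∅ := by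
      rw [hsu.symmDiff_eq_sup, Finset.sup_eq_union, Finset.union_eq_empty]
    simp only [this]
    split_ifs <;> simp_all
  | zero_left y hy => simp
  | zero_right x hx => simp
  | add_left x y z _ _ _ h₁ h₂ => rw [add_mul, map_add, map_add, h₁, h₂, add_mul]
  | add_right x y z _ _ _ h₁ h₂ => rw [mul_add, map_add, map_add, h₁, h₂, mul_add]
  | smul_left c x y _ _ h => rw [smul_mul_assoc, map_smul, map_smul, h, smul_mul_assoc]
  | smul_right c x y _ _ h => rw [mul_smul_comm, map_smul, map_smul, h, mul_smul_comm]

theorem canonicalTrace_prod_of_pairwise_disjoint {ι : Type*} (T : Finset ι) (I : ι → Set ℕ)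
    (hI : Pairwise fun i j => Disjoint (I i) (I j)) (y : ι → SetAlgebra)
    (hy : ∀ i, y i ∈ supportedSubalgebra (I i)) :
    canonicalTrace (∏ i ∈ T, y i) = ∏ i ∈ T, canonicalTrace (y i) := by
  classical
  induction T using Finset.induction_on with
  | empty => simpa using canonicalTrace_one
  | insert a T ha ih =>
    rw [Finset.prod_insert ha, Finset.prod_insert ha, ← ih]
    refine canonicalTrace_mul_of_disjoint (J := ⋃ i ∈ T, I i) ?_ (hy a) ?_
    · rw [Set.disjoint_iUnion₂_right]
      exact fun i hi => hI fun h => ha (h ▸ hi)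
    · exact Subalgebra.prod_mem _ fun i hi =>
        supportedSubalgebra_mono (Set.subset_biUnion_of_mem hi) (hy i)

/-! ### Elementary symmetric sums -/

/-- The sum of all `r`-element subsets of `I`. -/
noncomputable def elemSum (r : ℕ) (I : Finset ℕ) : SetAlgebra :=
  ∑ s ∈ I.powersetCard r, basisElement s

theorem elemSum_zero (I : Finset ℕ) : elemSum 0 I = 1 := by
  simp [elemSum, basisElement_empty]

theorem elemSum_succ_empty (r : ℕ) : elemSum (r + 1) ∅ = 0 := by
  rw [elemSum, Finset.powersetCard_eq_empty.2 (by simp), Finset.sum_empty]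

theorem elemSum_succ_insert (r : ℕ) {a : ℕ} {I : Finset ℕ} (h : a ∉ I) :
    elemSum (r + 1) (insert a I) = elemSum (r + 1) I + basisElement {a} * elemSum r I := by
  unfold elemSum
  rw [Finset.powersetCard_succ_insert h, Finset.sum_union, Finset.sum_image, Finset.mul_sum]
  · congr 1
    refine Finset.sum_congr rfl fun s hs => basisElement_insert fun ha => h ?_
    exact (Finset.mem_powersetCard.1 hs).1 ha
  · intro s hs u hu hsu
    have hs' : a ∉ s := fun ha => h ((Finset.mem_powersetCard.1 hs).1 ha)
    have hu' : a ∉ u := fun ha => h ((Finset.mem_powersetCard.1 hu).1 ha)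
    rw [← Finset.erase_insert hs', ← Finset.erase_insert hu']
    exact congrArg (fun v => v.erase a) hsu
  · rw [Finset.disjoint_left]
    intro s hs hs'
    obtain ⟨u, -, rfl⟩ := Finset.mem_image.1 hs'
    exact h ((Finset.mem_powersetCard.1 hs).1 (Finset.mem_insert_self a u))

/-- In `e_1 e_{r+1}`, a singleton either enlarges the set, each `(r+2)`-set arising `r+2` times, or
removes a point, each `r`-set arising `N - r` times. The proof is by induction on `I` rather than by
this count. The subtraction is in the algebra; for `r > N` the factor `e_r` vanishes. -/
theorem elemSum_recursion (I : Finset ℕ) (r : ℕ) :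
    ((r : SetAlgebra) + 2) * elemSum (r + 2) I =
      elemSum 1 I * elemSum (r + 1) I - ((I.card : SetAlgebra) - r) * elemSum r I := by
  induction I using Finset.induction_on generalizing r with
  | empty =>
    cases r with
    | zero => simp [elemSum_succ_empty]
    | succ r => simp [elemSum_succ_empty]
  | insert a I ha ih =>
    have hsq := basisElement_mul_self {a}
    rw [Finset.card_insert_of_notMem ha]
    simp only [elemSum_succ_insert _ ha]
    cases r with
    | zero =>
      have h := ih 0
      simp only [elemSum_zero] at h ⊢
      push_cast at h ⊢
      linear_combination h + hsq * (-1)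
    | succ r =>
      have h := ih (r + 1)
      have h' := ih r
      rw [elemSum_succ_insert _ ha]
      simp only [elemSum_zero] at h ⊢
      push_cast at h ⊢
      linear_combination h + basisElement {a} * h' - hsq * elemSum (r + 1) I

theorem canonicalTrace_elemSum_succ (r : ℕ) (I : Finset ℕ) :
    canonicalTrace (elemSum (r + 1) I) = 0 := by
  rw [elemSum, map_sum]
  refine Finset.sum_eq_zero fun s hs => ?_
  rw [canonicalTrace_basisElement, if_neg]
  rintro rfl
  simpa using (Finset.mem_powersetCard.1 hs).2

theorem elemSum_mem_supportedSubalgebra (r : ℕ) (I : Finset ℕ) :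
    elemSum r I ∈ supportedSubalgebra (I : Set ℕ) :=
  Subalgebra.sum_mem _ fun _ hs => basisElement_mem_supportedSubalgebra
    (Finset.coe_subset.2 (Finset.mem_powersetCard.1 hs).1)

/-- Such tuples are the bijections from `Fin r` onto `s`. -/
theorem card_injective_image_eq {r : ℕ} {s : Finset ℕ} (hs : s.card = r)
    (S : Finset (Fin r → ℕ))
    (hS : ∀ a, a ∈ S ↔ Function.Injective a ∧ Finset.univ.image a = s) :
    S.card = r.factorial := by
  have hc : Fintype.card (Fin r ≃ s) = r.factorial := by
    rw [Fintype.card_equiv (Fintype.equivOfCardEq (by simp [hs]))]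
    simp
  rw [← hc, ← Finset.card_univ]
  symm
  refine Finset.card_bij (fun e _ i => (e i : ℕ)) ?_ ?_ ?_
  · intro e _
    refine (hS _).2 ⟨Subtype.val_injective.comp e.injective, ?_⟩
    ext b
    simp only [Finset.mem_image, Finset.mem_univ, true_and]
    exact ⟨by rintro ⟨i, rfl⟩; exact (e i).2, fun hb => ⟨e.symm ⟨b, hb⟩, by simp⟩⟩
  · intro e _ f _ h
    ext i
    exact congrFun h i
  · intro a ha
    obtain ⟨hinj, him⟩ := (hS a).1 ha
    have hmem : ∀ i, a i ∈ s := fun i => him ▸ Finset.mem_image_of_mem a (Finset.mem_univ i)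
    refine ⟨Equiv.ofBijective (fun i => (⟨a i, hmem i⟩ : s)) ⟨fun i j h => ?_, fun b => ?_⟩,
      Finset.mem_univ _, rfl⟩
    · exact hinj (congrArg Subtype.val h)
    · have hb : (b : ℕ) ∈ Finset.univ.image a := by
        rw [him]
        exact b.2
      rw [Finset.mem_image] at hb
      obtain ⟨i, -, hi⟩ := hb
      exact ⟨i, Subtype.ext hi⟩

open Classical in
theorem sum_injective_tuples (r : ℕ) (I : Finset ℕ) :
    ∑ a ∈ (Fintype.piFinset (fun _ : Fin r => I)).filter (fun a => Function.Injective a),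
      (AddMonoidAlgebra.single (toBoolRing (Finset.univ.image a)) 1 : SetAlgebra) =
      (r.factorial : SetAlgebra) * elemSum r I := by
  rw [← Finset.sum_fiberwise_of_maps_to (t := I.powersetCard r)
    (g := fun a : Fin r → ℕ => Finset.univ.image a), elemSum, Finset.mul_sum]
  · refine Finset.sum_congr rfl fun s hs => ?_
    rw [Finset.mem_powersetCard] at hs
    rw [Finset.sum_congr rfl (g := fun _ => basisElement s), Finset.sum_const, nsmul_eq_mul,
      card_injective_image_eq hs.2]
    · intro a
      simp only [Finset.mem_filter, Fintype.mem_piFinset]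
      refine ⟨fun h => ⟨h.1.2, h.2⟩, fun h => ⟨⟨fun i => hs.1 ?_, h.1⟩, h.2⟩⟩
      exact h.2 ▸ Finset.mem_image_of_mem a (Finset.mem_univ i)
    · intro a ha
      rw [← (Finset.mem_filter.1 ha).2]
      rfl
  · intro a ha
    rw [Finset.mem_filter, Fintype.mem_piFinset] at ha
    rw [Finset.mem_powersetCard, Finset.card_image_of_injective _ ha.2]
    refine ⟨fun b hb => ?_, by simp⟩
    obtain ⟨i, -, rfl⟩ := Finset.mem_image.1 hb
    exact ha.1 i

/-! ### Polynomials defined by a three-term recursion -/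

/-- The monic polynomials with `q₀ = 1`, `q₁ = X` and `q_{r+2} = X q_{r+1} - c_r q_r`. -/
noncomputable def recursivePoly (c : ℕ → ℝ) : ℕ → Polynomial ℝ
  | 0 => 1
  | 1 => Polynomial.X
  | r + 2 => Polynomial.X * recursivePoly c (r + 1) - Polynomial.C (c r) * recursivePoly c r

theorem natDegree_recursivePoly_le (c : ℕ → ℝ) (r : ℕ) : (recursivePoly c r).natDegree ≤ r := by
  induction r using Nat.twoStepInduction with
  | zero => simp [recursivePoly]
  | one => simp [recursivePoly]
  | more r h₀ h₁ =>
    rw [recursivePoly]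
    refine (Polynomial.natDegree_sub_le _ _).trans (max_le ?_ ?_)
    · refine Polynomial.natDegree_mul_le.trans ?_
      rw [Polynomial.natDegree_X]
      omega
    · exact (Polynomial.natDegree_C_mul_le _ _).trans (by omega)

theorem coeff_recursivePoly_self (c : ℕ → ℝ) (r : ℕ) : (recursivePoly c r).coeff r = 1 := by
  induction r using Nat.twoStepInduction with
  | zero => simp [recursivePoly]
  | one => simp [recursivePoly]
  | more r h₀ h₁ =>
    rw [recursivePoly, Polynomial.coeff_sub, Polynomial.coeff_X_mul, h₁, Polynomial.coeff_C_mul,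
      Polynomial.coeff_eq_zero_of_natDegree_lt, mul_zero, sub_zero]
    exact (natDegree_recursivePoly_le c r).trans_lt (by omega)

theorem recursivePoly_eq_X_pow_add (c : ℕ → ℝ) (r : ℕ) :
    recursivePoly c r =
      Polynomial.X ^ r +
        ∑ i ∈ Finset.range r, (recursivePoly c r).coeff i • (Polynomial.X : Polynomial ℝ) ^ i := by
  conv_lhs => rw [Polynomial.as_sum_range_C_mul_X_pow' (n := r + 1) (recursivePoly c r)
    (Nat.lt_succ_of_le (natDegree_recursivePoly_le c r))]
  rw [Finset.sum_range_succ, coeff_recursivePoly_self, add_comm]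
  simp [Polynomial.smul_eq_C_mul]

/-- For `c_r = (r + 1) v`, the polynomials of the recursion form an Appell sequence. -/
theorem derivative_recursivePoly_succ (v : ℝ) (r : ℕ) :
    Polynomial.derivative (recursivePoly (fun k => ((k : ℝ) + 1) * v) (r + 1)) =
      Polynomial.C ((r : ℝ) + 1) * recursivePoly (fun k => ((k : ℝ) + 1) * v) r := by
  induction r using Nat.twoStepInduction with
  | zero => simp [recursivePoly]
  | one => simp [recursivePoly]; norm_num [Polynomial.C_ofNat]; ring
  | more r h₀ h₁ =>
    rw [recursivePoly, Polynomial.derivative_sub, Polynomial.derivative_mul,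
      Polynomial.derivative_X, Polynomial.derivative_C_mul, h₀, h₁, recursivePoly]
    push_cast
    simp only [Polynomial.C_add, Polynomial.C_mul, Polynomial.C_1, Polynomial.C_ofNat]
    ring

/-! ### Coefficientwise convergence of polynomials of bounded degree -/

/-- Coefficientwise convergence of a sequence of polynomials of bounded degree. -/
def PolyTendsto (P : ℕ → Polynomial ℝ) (Q : Polynomial ℝ) : Prop :=
  (∃ d, ∀ n, (P n).natDegree ≤ d) ∧ ∀ j, Tendsto (fun n => (P n).coeff j) atTop (𝓝 (Q.coeff j))

theorem PolyTendsto.const (Q : Polynomial ℝ) : PolyTendsto (fun _ => Q) Q :=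
  ⟨⟨_, fun _ => le_rfl⟩, fun _ => tendsto_const_nhds⟩

theorem PolyTendsto.C {c : ℕ → ℝ} {a : ℝ} (h : Tendsto c atTop (𝓝 a)) :
    PolyTendsto (fun n => Polynomial.C (c n)) (Polynomial.C a) := by
  refine ⟨⟨0, fun n => by simp⟩, fun j => ?_⟩
  simp only [Polynomial.coeff_C]
  split_ifs
  · exact h
  · exact tendsto_const_nhds

theorem PolyTendsto.sub {P P' : ℕ → Polynomial ℝ} {Q Q' : Polynomial ℝ}
    (h : PolyTendsto P Q) (h' : PolyTendsto P' Q') :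
    PolyTendsto (fun n => P n - P' n) (Q - Q') := by
  obtain ⟨⟨d, hd⟩, h⟩ := h
  obtain ⟨⟨d', hd'⟩, h'⟩ := h'
  refine ⟨⟨max d d', fun n => (Polynomial.natDegree_sub_le _ _).trans
    (max_le_max (hd n) (hd' n))⟩, fun j => ?_⟩
  simp only [Polynomial.coeff_sub]
  exact (h j).sub (h' j)

theorem PolyTendsto.mul {P P' : ℕ → Polynomial ℝ} {Q Q' : Polynomial ℝ}
    (h : PolyTendsto P Q) (h' : PolyTendsto P' Q') :
    PolyTendsto (fun n => P n * P' n) (Q * Q') := by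
  obtain ⟨⟨d, hd⟩, h⟩ := h
  obtain ⟨⟨d', hd'⟩, h'⟩ := h'
  refine ⟨⟨d + d', fun n => Polynomial.natDegree_mul_le.trans
    (add_le_add (hd n) (hd' n))⟩, fun j => ?_⟩
  simp only [Polynomial.coeff_mul]
  exact tendsto_finsetSum _ fun i _ => (h _).mul (h' _)

theorem PolyTendsto.pow {P : ℕ → Polynomial ℝ} {Q : Polynomial ℝ} (h : PolyTendsto P Q) (k : ℕ) :
    PolyTendsto (fun n => P n ^ k) (Q ^ k) := by
  induction k with
  | zero => simpa using PolyTendsto.const 1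
  | succ k ih =>
    simp only [pow_succ]
    exact ih.mul h

theorem polyTendsto_recursivePoly {c : ℕ → ℕ → ℝ} {b : ℕ → ℝ}
    (h : ∀ r, Tendsto (fun n => c n r) atTop (𝓝 (b r))) (r : ℕ) :
    PolyTendsto (fun n => recursivePoly (c n) r) (recursivePoly b r) := by
  induction r using Nat.twoStepInduction with
  | zero => exact PolyTendsto.const 1
  | one => exact PolyTendsto.const Polynomial.X
  | more r h₀ h₁ =>
    simp only [recursivePoly]
    exact ((PolyTendsto.const _).mul h₁).sub ((PolyTendsto.C (h r)).mul h₀)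

/-- The degree bound turns all the values into sums over one fixed finite range, where limits pass
termwise. -/
theorem PolyTendsto.tendsto_apply {φ : ℕ → Polynomial ℝ →ₗ[ℝ] ℂ} {Φ : Polynomial ℝ →ₗ[ℝ] ℂ}
    (hφ : ∀ j, Tendsto (fun n => φ n (Polynomial.X ^ j)) atTop (𝓝 (Φ (Polynomial.X ^ j))))
    {P : ℕ → Polynomial ℝ} {Q : Polynomial ℝ} (h : PolyTendsto P Q) :
    Tendsto (fun n => φ n (P n)) atTop (𝓝 (Φ Q)) := by
  obtain ⟨⟨d, hd⟩, h⟩ := h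
  have key : ∀ (f : Polynomial ℝ →ₗ[ℝ] ℂ) (R : Polynomial ℝ) (D : ℕ), R.natDegree ≤ D →
      f R = ∑ i ∈ Finset.range (D + 1), R.coeff i • f (Polynomial.X ^ i) := by
    intro f R D hR
    conv_lhs => rw [Polynomial.as_sum_range_C_mul_X_pow' (n := D + 1) R (Nat.lt_succ_of_le hR)]
    simp only [map_sum, ← Polynomial.smul_eq_C_mul, map_smul]
  rw [key Φ Q (max d Q.natDegree) (le_max_right _ _)]
  simp only [fun n => key (φ n) (P n) (max d Q.natDegree) ((hd n).trans (le_max_left _ _))]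
  exact tendsto_finsetSum _ fun i _ => (h i).smul (hφ i)

/-- Linear forms that agree on polynomials of a convergent three-term recursion converge. -/
theorem tendsto_moments_of_recursivePoly {φ : ℕ → Polynomial ℝ →ₗ[ℝ] ℂ}
    {Φ : Polynomial ℝ →ₗ[ℝ] ℂ} {c : ℕ → ℕ → ℝ} {b : ℕ → ℝ}
    (hc : ∀ r, Tendsto (fun n => c n r) atTop (𝓝 (b r)))
    (h : ∀ r n, φ n (recursivePoly (c n) r) = Φ (recursivePoly b r)) (j : ℕ) :
    Tendsto (fun n => φ n (Polynomial.X ^ j)) atTop (𝓝 (Φ (Polynomial.X ^ j))) := by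
  induction j using Nat.strong_induction_on with
  | _ j ih =>
    -- Monicity expresses the `j`-th moment through the value at `q_j` and strictly lower moments.
    have key : ∀ (f : Polynomial ℝ →ₗ[ℝ] ℂ) (a : ℕ → ℝ), f (Polynomial.X ^ j) =
        f (recursivePoly a j) -
          ∑ i ∈ Finset.range j, (recursivePoly a j).coeff i • f (Polynomial.X ^ i) := by
      intro f a
      have := congrArg f (recursivePoly_eq_X_pow_add a j)
      rw [map_add, map_sum] at this
      simp only [map_smul] at this
      rw [this, add_sub_cancel_right]
    rw [key Φ b]
    simp only [fun n => key (φ n) (c n)]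
    refine Tendsto.sub ?_ (tendsto_finsetSum _ fun i hi => ?_)
    · exact tendsto_const_nhds.congr fun n => (h j n).symm
    · exact ((polyTendsto_recursivePoly hc j).2 i).smul (ih i (Finset.mem_range.1 hi))

/-! ### Gaussian moments -/

theorem integrable_pow_gaussianReal (v : NNReal) (j : ℕ) :
    Integrable (fun x : ℝ => x ^ j) (gaussianReal 0 v) := by
  have h : (0 : ℝ) ∈ interior (integrableExpSet id (gaussianReal 0 v)) := by simp
  simpa using integrable_pow_of_mem_interior_integrableExpSet h j

theorem integrable_eval_gaussianReal (v : NNReal) (P : Polynomial ℝ) :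
    Integrable (fun x : ℝ => P.eval x) (gaussianReal 0 v) := by
  induction P using Polynomial.induction_on' with
  | add P Q hP hQ =>
    simp only [Polynomial.eval_add]
    exact hP.add hQ
  | monomial n a =>
    simp only [Polynomial.eval_monomial]
    exact (integrable_pow_gaussianReal v n).const_mul a

theorem memLp_eval_gaussianReal (v : NNReal) (P : Polynomial ℝ) (q : ℕ) :
    MemLp (fun x : ℝ => P.eval x) q (gaussianReal 0 v) := by
  have hm : AEStronglyMeasurable (fun x : ℝ => P.eval x) (gaussianReal 0 v) :=
    P.continuous.aestronglyMeasurable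
  -- The even exponent makes `|P|^(2q)` a polynomial; one then descends to `q` because the measure
  -- is finite.
  have h2 : MemLp (fun x : ℝ => P.eval x) ((2 * q : ℕ) : ENNReal) (gaussianReal 0 v) := by
    rcases Nat.eq_zero_or_pos q with rfl | hq
    · simpa using hm
    · rw [← integrable_norm_rpow_iff hm (by simp; omega) (ENNReal.natCast_ne_top _)]
      refine (integrable_eval_gaussianReal v (P ^ (2 * q))).congr (ae_of_all _ fun x => ?_)
      simp only [Polynomial.eval_pow, ENNReal.toReal_natCast, Real.rpow_natCast]
      rw [Real.norm_eq_abs, pow_mul, pow_mul, sq_abs]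
  exact h2.mono_exponent (by exact_mod_cast (by omega : q ≤ 2 * q))

/-- The moment generating function satisfies `M' = v t M`. In the Leibniz rule at 0, only the term
differentiating `t` exactly once survives. This also covers `v = 0`. -/
theorem integral_pow_add_two_gaussianReal (v : NNReal) (j : ℕ) :
    ∫ x, x ^ (j + 2) ∂gaussianReal 0 v = v * (j + 1) * ∫ x, x ^ j ∂gaussianReal 0 v := by
  have h : (0 : ℝ) ∈ interior (integrableExpSet id (gaussianReal 0 v)) := by simp
  have hm : ∀ k, ∫ x, x ^ k ∂gaussianReal 0 v =
      iteratedDeriv k (fun t : ℝ => Real.exp (v * t ^ 2 / 2)) 0 := by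
    intro k
    have := iteratedDeriv_mgf_zero h k
    rw [mgf_id_gaussianReal] at this
    simpa using this.symm
  have hd : deriv (fun t : ℝ => Real.exp (v * t ^ 2 / 2)) =
      fun t : ℝ => t * (v * Real.exp (v * t ^ 2 / 2)) := by
    ext t
    rw [_root_.deriv_exp (by fun_prop)]
    simp only [deriv_div_const, deriv_const_mul_field, deriv_pow_field]
    push_cast
    ring
  rw [hm, hm, iteratedDeriv_succ', hd, iteratedDeriv_fun_mul (by fun_prop) (by fun_prop),
    Finset.sum_eq_single 1]
  · simp only [iteratedDeriv_const_mul_field]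
    simp
    ring
  · intro i _ hi
    simp [iteratedDeriv_fun_id_zero, hi]
  · simp

theorem integral_id_gaussianReal_zero (v : NNReal) : ∫ x, x ^ 1 ∂gaussianReal 0 v = 0 := by
  simp

/-- The expectation of polynomials under the centered Gaussian law of variance `v`. -/
noncomputable def gaussianFunctional (v : NNReal) : Polynomial ℝ →ₗ[ℝ] ℂ where
  toFun P := ((∫ x, P.eval x ∂gaussianReal 0 v : ℝ) : ℂ)
  map_add' P Q := by
    simp only [Polynomial.eval_add]
    rw [integral_add (integrable_eval_gaussianReal v P) (integrable_eval_gaussianReal v Q)]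
    push_cast
    rfl
  map_smul' a P := by
    simp only [Polynomial.eval_smul, smul_eq_mul, integral_const_mul, RingHom.id_apply]
    push_cast
    rfl

theorem gaussianFunctional_apply (v : NNReal) (P : Polynomial ℝ) :
    gaussianFunctional v P = ((∫ x, P.eval x ∂gaussianReal 0 v : ℝ) : ℂ) := rfl

/-- Gaussian integration by parts, read off from the moment recursion on monomials. -/
theorem gaussianFunctional_X_mul (v : NNReal) (P : Polynomial ℝ) :
    gaussianFunctional v (Polynomial.X * P) =
      (v : ℝ) • gaussianFunctional v (Polynomial.derivative P) := by
  induction P using Polynomial.induction_on' with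
  | add P Q hP hQ => rw [mul_add, map_add, hP, hQ, map_add, map_add, smul_add]
  | monomial n a =>
    rw [Polynomial.X_mul_monomial, Polynomial.derivative_monomial]
    simp only [gaussianFunctional_apply, Polynomial.eval_monomial, integral_const_mul]
    rcases n with _ | n
    · rw [integral_id_gaussianReal_zero]
      simp
    · rw [integral_pow_add_two_gaussianReal, Complex.real_smul, ← Complex.ofReal_mul]
      congr 1
      push_cast
      ring

theorem gaussianFunctional_one (v : NNReal) : gaussianFunctional v 1 = 1 := by
  simp [gaussianFunctional_apply]

/-- Integration by parts and the Appell property turn `X q_{r+1}` into `(r+1) v q_r` under the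
expectation, which the recursion subtracts. -/
theorem gaussianFunctional_recursivePoly_succ (v : NNReal) (r : ℕ) :
    gaussianFunctional v (recursivePoly (fun k => ((k : ℝ) + 1) * v) (r + 1)) = 0 := by
  cases r with
  | zero =>
    have := gaussianFunctional_X_mul v 1
    simpa [recursivePoly] using this
  | succ r =>
    rw [recursivePoly, map_sub, gaussianFunctional_X_mul, derivative_recursivePoly_succ,
      ← Polynomial.smul_eq_C_mul, ← Polynomial.smul_eq_C_mul, map_smul, map_smul, smul_smul,
      mul_comm, sub_self]

/-! ### The asymptotic number of integers in an interval -/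

theorem integersIoc_disjoint {s t s' t' : ℝ} (h : t ≤ s') :
    Disjoint (integersIoc s t : Set ℕ) (integersIoc s' t') := by
  rw [Finset.disjoint_coe, Finset.disjoint_left]
  intro a ha ha'
  rw [mem_integersIoc] at ha ha'
  linarith [ha.2, ha'.1]

theorem tendsto_floor_mul_div (t : ℝ) (ht : 0 ≤ t) :
    Tendsto (fun n : ℕ => (⌊(n : ℝ) * t⌋₊ : ℝ) / n) atTop (𝓝 t) := by
  have := (tendsto_nat_floor_mul_div_atTop (R := ℝ) ht).comp tendsto_natCast_atTop_atTop
  simpa [Function.comp_def, mul_comm] using this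

/-- Only nonnegative integers count, so both endpoints are clipped at 0; the limit is 0 when `t ≤
0`. -/
theorem tendsto_card_integersIoc_div {s t : ℝ} (hst : s < t) :
    Tendsto (fun n : ℕ => ((integersIoc (n * s) (n * t)).card : ℝ) / n) atTop
      (𝓝 (max t 0 - max s 0)) := by
  rcases lt_or_ge t 0 with ht | ht
  · rw [max_eq_right ht.le, max_eq_right (hst.trans ht).le, sub_self]
    refine tendsto_const_nhds.congr' ?_
    filter_upwards [eventually_gt_atTop 0] with n hn
    have hn' : (0 : ℝ) < n := by exact_mod_cast hn
    rw [Finset.card_eq_zero.2, Nat.cast_zero, zero_div]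
    refine Finset.eq_empty_of_forall_notMem fun a ha => ?_
    rw [mem_integersIoc] at ha
    have := mul_neg_of_pos_of_neg hn' ht
    have := Nat.cast_nonneg (α := ℝ) a
    linarith [ha.2]
  rw [max_eq_left ht]
  rcases lt_or_ge s 0 with hs | hs
  · rw [max_eq_right hs.le, sub_zero]
    -- For `s < 0` the integer 0 belongs to the interval, whence the extra `1 / n`.
    have h := (tendsto_floor_mul_div t ht).add (tendsto_one_div_atTop_nhds_zero_nat (𝕜 := ℝ))
    rw [add_zero] at h
    refine h.congr' ?_
    filter_upwards [eventually_gt_atTop 0] with n hn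
    have hn' : (0 : ℝ) < n := by exact_mod_cast hn
    have : integersIoc (n * s) (n * t) = Finset.range (⌊(n : ℝ) * t⌋₊ + 1) := by
      ext a
      rw [mem_integersIoc, Finset.mem_range, Nat.lt_succ_iff, Nat.le_floor_iff (by positivity)]
      refine and_iff_right ?_
      have := mul_neg_of_pos_of_neg hn' hs
      have := Nat.cast_nonneg (α := ℝ) a
      linarith
    rw [this, Finset.card_range]
    push_cast
    ring
  · rw [max_eq_left hs]
    refine ((tendsto_floor_mul_div t ht).sub (tendsto_floor_mul_div s hs)).congr fun n => ?_
    have : integersIoc (n * s) (n * t) = Finset.Ioc ⌊(n : ℝ) * s⌋₊ ⌊(n : ℝ) * t⌋₊ := by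
      ext a
      rw [mem_integersIoc, Finset.mem_Ioc, Nat.le_floor_iff (by positivity),
        Nat.floor_lt (by positivity)]
    rw [this, Nat.card_Ioc, Nat.cast_sub (Nat.floor_le_floor (by gcongr))]
    ring

/-! ### The normalized sums -/

theorem normalizedSum_eq (r : ℕ) (s t : ℝ) (n : ℕ) :
    normalizedSum r s t n =
      (((n : ℝ) ^ (-(r : ℝ) / 2) : ℝ) : ℂ) •
        ((r.factorial : SetAlgebra) * elemSum r (integersIoc (n * s) (n * t))) := by
  rw [normalizedSum, sum_injective_tuples]

theorem normalizedSum_zero (s t : ℝ) (n : ℕ) : normalizedSum 0 s t n = 1 := by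
  simp [normalizedSum_eq, elemSum_zero]

theorem canonicalTrace_normalizedSum_succ (r : ℕ) (s t : ℝ) (n : ℕ) :
    canonicalTrace (normalizedSum (r + 1) s t n) = 0 := by
  rw [normalizedSum_eq, ← nsmul_eq_mul, LinearMap.map_smul, LinearMap.map_smul_of_tower,
    canonicalTrace_elemSum_succ, smul_zero, smul_zero]

theorem normalizedSum_mem_supportedSubalgebra (r : ℕ) (s t : ℝ) (n : ℕ) :
    normalizedSum r s t n ∈ supportedSubalgebra (integersIoc (n * s) (n * t) : Set ℕ) := by
  rw [normalizedSum_eq]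
  exact Subalgebra.smul_mem _ (Subalgebra.mul_mem _ (Subalgebra.natCast_mem _ _)
    (elemSum_mem_supportedSubalgebra _ _)) _

theorem natCast_rpow_neg_div_two (n r : ℕ) :
    (n : ℝ) ^ (-(r : ℝ) / 2) = ((n : ℝ) ^ (-(1 : ℝ) / 2)) ^ r := by
  rw [← Real.rpow_mul_natCast (Nat.cast_nonneg n)]
  congr 1
  ring

/-- The coefficients of the three-term recursion of the normalized sums. -/
noncomputable def recursionCoeff (s t : ℝ) (n r : ℕ) : ℝ :=
  ((r : ℝ) + 1) * (((integersIoc (n * s) (n * t)).card : ℝ) - r) / n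

theorem tendsto_recursionCoeff {s t : ℝ} (hst : s < t) (r : ℕ) :
    Tendsto (fun n => recursionCoeff s t n r) atTop
      (𝓝 (((r : ℝ) + 1) * (max t 0 - max s 0))) := by
  have h := ((tendsto_card_integersIoc_div hst).sub
    (tendsto_const_div_atTop_nhds_zero_nat (r : ℝ))).const_mul ((r : ℝ) + 1)
  rw [sub_zero] at h
  refine h.congr fun n => ?_
  rw [recursionCoeff]
  ring

theorem normalizedSum_recursion (s t : ℝ) (n r : ℕ) :
    normalizedSum (r + 2) s t n =
      normalizedSum 1 s t n * normalizedSum (r + 1) s t n -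
        recursionCoeff s t n r • normalizedSum r s t n := by
  -- At `n = 0` both sides are 0 by convention, so the recursion holds for every `n`.
  have hw : ((n : ℝ) ^ (-(1 : ℝ) / 2)) ^ 2 = 1 / n := by
    rw [← Real.rpow_mul_natCast (Nat.cast_nonneg n)]
    norm_num [Real.rpow_neg_one]
  have hrec := elemSum_recursion (integersIoc (n * s) (n * t)) r
  simp only [normalizedSum_eq, natCast_rpow_neg_div_two]
  generalize (n : ℝ) ^ (-(1 : ℝ) / 2) = w at hw
  rw [recursionCoeff, mul_div_assoc, div_eq_mul_one_div _ (n : ℝ), ← hw]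
  rw [← algebraMap_smul ℂ (_ : ℝ) (_ : SetAlgebra)]
  simp only [Algebra.smul_def, Nat.factorial_succ, Nat.factorial_zero]
  push_cast
  linear_combination (Algebra.cast (w : ℂ) : SetAlgebra) ^ (r + 2) * ((r : SetAlgebra) + 1) *
    (r.factorial : SetAlgebra) * hrec

theorem normalizedSum_eq_aeval (s t : ℝ) (n r : ℕ) :
    normalizedSum r s t n =
      Polynomial.aeval (normalizedSum 1 s t n) (recursivePoly (recursionCoeff s t n) r) := by
  induction r using Nat.twoStepInduction with
  | zero => simp [recursivePoly, normalizedSum_zero]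
  | one => simp [recursivePoly]
  | more r h₀ h₁ =>
    rw [recursivePoly, map_sub, ← Polynomial.smul_eq_C_mul, map_mul, map_smul,
      Polynomial.aeval_X, ← h₀, ← h₁, normalizedSum_recursion]

/-- The moment functional of `x` with respect to the canonical trace. -/
noncomputable def traceFunctional (x : SetAlgebra) : Polynomial ℝ →ₗ[ℝ] ℂ :=
  canonicalTrace.restrictScalars ℝ ∘ₗ (Polynomial.aeval x).toLinearMap

theorem traceFunctional_apply (x : SetAlgebra) (P : Polynomial ℝ) :
    traceFunctional x P = canonicalTrace (Polynomial.aeval x P) := rfl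

/-- The variance of the limit of the normalized sum of the generators indexed by `(n s, n t]`. -/
noncomputable def limitVariance (s t : ℝ) : NNReal := (max t 0 - max s 0).toNNReal

theorem coe_limitVariance {s t : ℝ} (hst : s < t) :
    (limitVariance s t : ℝ) = max t 0 - max s 0 :=
  Real.coe_toNNReal _ (sub_nonneg.2 (max_le_max_right 0 hst.le))

/-- The Hermite polynomial of degree `r` for the Gaussian law of variance `v`. -/
noncomputable def hermitePoly (v : NNReal) (r : ℕ) : Polynomial ℝ :=
  recursivePoly (fun k => ((k : ℝ) + 1) * v) r

theorem tendsto_canonicalTrace_normalizedSum_pow {s t : ℝ} (hst : s < t) (r k : ℕ) :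
    Tendsto (fun n => canonicalTrace (normalizedSum r s t n ^ k)) atTop
      (𝓝 (gaussianFunctional (limitVariance s t) (hermitePoly (limitVariance s t) r ^ k))) := by
  have hc : ∀ r, Tendsto (fun n => recursionCoeff s t n r) atTop
      (𝓝 (((r : ℝ) + 1) * limitVariance s t)) := by
    intro r
    rw [coe_limitVariance hst]
    exact tendsto_recursionCoeff hst r
  have hmom := tendsto_moments_of_recursivePoly
    (φ := fun n => traceFunctional (normalizedSum 1 s t n))
    (Φ := gaussianFunctional (limitVariance s t)) hc (fun r n => by
      rw [traceFunctional_apply, ← normalizedSum_eq_aeval]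
      cases r with
      | zero =>
        rw [normalizedSum_zero, canonicalTrace_one, recursivePoly, gaussianFunctional_one]
      | succ r =>
        rw [canonicalTrace_normalizedSum_succ, gaussianFunctional_recursivePoly_succ])
  refine (PolyTendsto.tendsto_apply hmom
    ((polyTendsto_recursivePoly hc r).pow k)).congr fun n => ?_
  rw [traceFunctional_apply, map_pow, ← normalizedSum_eq_aeval]

/-! ### Reduction to monomials -/

/-- Evaluation in a commutative algebra factors through commutative polynomials, so only monomials
`∏ x_i ^ m_i` matter. -/
theorem freeAlgebra_lift_eq_aeval {A ι : Type*} [CommRing A] [Algebra ℂ A] (x : ι → A)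
    (P : FreeAlgebra ℂ ι) :
    FreeAlgebra.lift ℂ x P =
      MvPolynomial.aeval x (FreeAlgebra.lift ℂ (MvPolynomial.X : ι → MvPolynomial ι ℂ) P) := by
  have : FreeAlgebra.lift ℂ x = (MvPolynomial.aeval x).comp
      (FreeAlgebra.lift ℂ (MvPolynomial.X : ι → MvPolynomial ι ℂ)) := by
    ext i
    simp
  rw [this]
  rfl

theorem freeAlgebra_lift_eq_sum {A ι : Type*} [Fintype ι] [CommRing A] [Algebra ℂ A] (x : ι → A)
    (P : FreeAlgebra ℂ ι) :
    FreeAlgebra.lift ℂ x P =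
      ∑ m ∈ (FreeAlgebra.lift ℂ (MvPolynomial.X : ι → MvPolynomial ι ℂ) P).support,
        (FreeAlgebra.lift ℂ (MvPolynomial.X : ι → MvPolynomial ι ℂ) P).coeff m •
          ∏ i, x i ^ m i := by
  rw [freeAlgebra_lift_eq_aeval, MvPolynomial.aeval_def, MvPolynomial.eval₂_eq']
  simp only [Algebra.smul_def]

theorem tendsto_canonicalTrace_prod {p : ℕ} (r : Fin p → ℕ) (t : Fin (p + 1) → ℝ)
    (ht : StrictMono t) (m : Fin p → ℕ) :
    Tendsto (fun n : ℕ => canonicalTrace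
        (∏ i, normalizedSum (r i) (t i.castSucc) (t i.succ) n ^ m i)) atTop
      (𝓝 (∏ i, gaussianFunctional (limitVariance (t i.castSucc) (t i.succ))
        (hermitePoly (limitVariance (t i.castSucc) (t i.succ)) (r i) ^ m i))) := by
  refine (tendsto_finsetProd _ fun i _ => tendsto_canonicalTrace_normalizedSum_pow
    (ht (Fin.castSucc_lt_succ (i := i))) (r i) (m i)).congr fun n => ?_
  refine (canonicalTrace_prod_of_pairwise_disjoint Finset.univ
    (fun i => (integersIoc (n * t i.castSucc) (n * t i.succ) : Set ℕ)) ?_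
    (fun i => normalizedSum (r i) (t i.castSucc) (t i.succ) n ^ m i) fun i =>
      Subalgebra.pow_mem _ (normalizedSum_mem_supportedSubalgebra _ _ _ _) _).symm
  have h : ∀ i j : Fin p, i < j → (n : ℝ) * t i.succ ≤ n * t j.castSucc := fun i j hij =>
    mul_le_mul_of_nonneg_left (ht.monotone (Fin.succ_le_castSucc_iff.2 hij)) (Nat.cast_nonneg n)
  intro i j hij
  rcases lt_or_gt_of_ne hij with hlt | hlt
  · exact integersIoc_disjoint (h i j hlt)
  · exact (integersIoc_disjoint (h j i hlt)).symm

theorem mainTheorem7 (p : ℕ) (hp : 1 ≤ p) (r : Fin p → ℕ) (t : Fin (p + 1) → ℝ)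
    (ht : StrictMono t) :
    AsymptoticallyIndependent canonicalTrace
      (fun (n : ℕ) (i : Fin p) => normalizedSum (r i) (t i.castSucc) (t i.succ) n) := by
  set v : Fin p → NNReal := fun i => limitVariance (t i.castSucc) (t i.succ) with hv
  set H : Fin p → Polynomial ℝ := fun i => hermitePoly (v i) (r i) with hH
  -- The witness is a product of centered Gaussians, with `X_i` the Hermite polynomial of degree `r
  -- i` in the `i`-th coordinate.
  refine ⟨Fin p → ℝ, inferInstance, Measure.pi fun i => gaussianReal 0 (v i),
    fun i ω => (H i).eval (ω i), inferInstance, fun i => ?_, fun i q => ?_, ?_, fun P => ?_⟩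
  · exact (H i).continuous.measurable.comp (measurable_pi_apply i)
  · exact (memLp_eval_gaussianReal (v i) (H i) q).comp_measurePreserving
      (measurePreserving_eval (fun i => gaussianReal 0 (v i)) i)
  · exact iIndepFun_pi fun i => (H i).continuous.aemeasurable
  · have hint : ∀ (m : Fin p → ℕ) (i : Fin p),
        Integrable (fun x : ℝ => (((H i).eval x : ℝ) : ℂ) ^ m i) (gaussianReal 0 (v i)) := by
      intro m i
      have := (integrable_eval_gaussianReal (v i) (H i ^ m i)).ofReal (𝕜 := ℂ)
      simpa using this
    have h₁ := fun n : ℕ => freeAlgebra_lift_eq_sum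
      (fun i => normalizedSum (r i) (t i.castSucc) (t i.succ) n) P
    have h₂ := fun ω : Fin p → ℝ =>
      freeAlgebra_lift_eq_sum (fun i => (((H i).eval (ω i) : ℝ) : ℂ)) P
    -- The same commutative polynomial `Q` governs the trace and the expectation, so both are
    -- compared monomial by monomial.
    generalize FreeAlgebra.lift ℂ (MvPolynomial.X : Fin p → MvPolynomial (Fin p) ℂ) P = Q at h₁ h₂
    simp only [ncDistribution, LinearMap.comp_apply, AlgHom.toLinearMap_apply, h₁, h₂,
      map_sum, map_smul]
    have hint' : ∀ m ∈ Q.support, Integrable (fun ω : Fin p → ℝ =>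
        Q.coeff m • ∏ i, (((H i).eval (ω i) : ℝ) : ℂ) ^ m i)
        (Measure.pi fun i => gaussianReal 0 (v i)) :=
      fun m _ => (Integrable.fintype_prod (hint m)).fun_smul (Q.coeff m)
    rw [integral_finsetSum _ hint']
    refine tendsto_finsetSum _ fun m _ => ?_
    rw [integral_smul, integral_fintype_prod_eq_prod
      (f := fun i (x : ℝ) => (((H i).eval x : ℝ) : ℂ) ^ m i)]
    refine Tendsto.const_smul ?_ _
    have := tendsto_canonicalTrace_prod r t ht m
    convert this using 2
    refine Finset.prod_congr rfl fun i _ => ?_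
    rw [gaussianFunctional_apply, ← integral_complex_ofReal]
    simp [hH, hv]
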